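/- Let $m,\nu,\kappa>0$ and $\nu_\kappa=\sqrt{\nu^2+2\kappa/m}$. Let $\mathcal S=\mathcal B=\mathbb R^2$ be the phase spaces of a system and a bath, with canonical coordinates $(q_S,p_S)$ and $(q_B,p_B)$, and let $$H=\frac{p_S^2+p_B^2}{2m}+\frac{m\nu^2}{2}(q_S^2+q_B^2)+\frac{\kappa}{2}(q_S-q_B)^2$$ be the Hamiltonian of two linearly coupled oscillators on $\mathcal S\times\mathcal B=\mathbb R^4$. For complex-valued smooth functions, let $\star$ be the Weyl–Moyal star product on $C^\infty(\mathcal S\times\mathcal B)[[\hbar]]$, $$f\star g=\sum_{r\ge 0}\sum_{l=0}^{r}\Big(-\frac{i}{2}\Big)^{r-l}\Big(\frac{i}{2}\Big)^{l}\frac{\hbar^r}{l!\,(r-l)!}\sum_{i_1,\dots,i_r\in\{S,B\}}\frac{\partial^r f}{\partial q_{i_1}\cdots\partial q_{i_l}\partial p_{i_{l+1}}\cdots\partial p_{i_r}}\,\frac{\partial^r g}{\partial p_{i_1}\cdots\partial p_{i_l}\partial q_{i_{l+1}}\cdots\partial q_{i_r}},$$ and let $\star_B$ be the same product on $C^\infty(\mathcal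 B)[[\hbar]]$. Put $q_{1,2}=(q_S\pm q_B)/\sqrt2$, $p_{1,2}=(p_S\pm p_B)/\sqrt2$, $\nu_1=\nu$, $\nu_2=\nu_\kappa$, $z_k=\sqrt{m\nu_k}\,q_k+\frac{i}{\sqrt{m\nu_k}}\,p_k$, and let $S=\exp(\hbar\Delta)$ with $\Delta=\sum_{k=1}^2\frac{\partial^2}{\partial z_k\partial\bar z_k}$ (the equivalence from $\star$ to the Wick star product). Then the following hold. 1. The Hamiltonian vector field $X_H=\{\cdot,H\}$ (with $\{q,p\}=1$) has a unique complete flow $\Phi_t$; it is linear, and in the coordinates $(q_S,p_S,q_B,p_B)$ it is $\Phi_t=\frac12\begin{pmatrix}P_t&M_t\\M_t&P_t\end{pmatrix}$, where $$P_t,\,M_t=\begin{pmatrix}\cos\nu t\pm\cos\nu_\kappa t&\frac{\sin\nu t}{m\nu}\pm\frac{\sin\nu_\kappa t}{m\nu_\kappa}\\-m(\nu\sin\nu t\pm\nu_\kappa\sin\nu_\kappa t)&\cos\nu t\pm\cos\nu_\kappa t\end{pmatrix}$$ with the upper signs for $P_t$ and the lower signs for $M_t$. 2. The total quantum time evolution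 with respect to $\star$ and $H$ exists and is $$A_t=S^{-1}\circ\Phi_t^*\circ S .$$ That is, for every $f\in C^\infty(\mathcal S\times\mathcal B)[[\hbar]]$ the curve $t\mapsto A_tf$ is the unique solution $f(t)$, $t\in\mathbb R$, of the Heisenberg equation $\frac{d}{dt}f(t)=\frac{i}{\hbar}\big(H\star f(t)-f(t)\star H\big)$ with $f(0)=f$, the derivative being taken order by order in $\hbar$ in the smooth topology. 3. Let $\omega=\sum_r\hbar^r\omega_r:C^\infty(\mathcal B)[[\hbar]]\to\mathbb C[[\hbar]]$ be a $\mathbb C[[\hbar]]$-linear functional such that $\omega(\bar f\star_B f)\ge0$ for all $f$ and each $\omega_r$ is continuous for the smooth topology. (A series in $\mathbb C[[\hbar]]$ is $\geq 0$ if it is zero, or if it is real and its lowest non-zero coefficient is positive.) Then the quantized open time evolution $A_t^\omega=(\mathrm{id}\otimes\omega)\circ A_t\circ\mathrm{pr}_S^*$ on $C^\infty(\mathcal S)[[\hbar]]$ is $$A_t^\omega=(\mathrm{id}\otimes\omega)\circ S^{-1}\circ\Phi_t^*\circ S\circ\mathrm{pr}_S^*\qquad\text{for all }t\in\mathbb R,$$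 where $\mathrm{id}\otimes\omega$ is defined order by order in $\hbar$, with $((\mathrm{id}\otimes\omega_r)F)(x)=\omega_r(F(x,\cdot))$, and $\mathrm{pr}_S:\mathcal S\times\mathcal B\to\mathcal S$ is the projection. -/

import Mathlib

open scoped ContDiff PowerSeries
open Filter Topology

noncomputable section

namespace OpenOsc

/-- The algebra of smooth complex-valued functions on `E`, as a subalgebra of all functions. -/
def smoothSubalgebra (E : Type*) [NormedAddCommGroup E] [NormedSpace ℝ E] :
    Subalgebra ℂ (E → ℂ) where
  carrier := {f | ContDiff ℝ ∞ f}
  mul_mem' {f g} (hf : ContDiff ℝ ∞ f) (hg : ContDiff ℝ ∞ g) := hf.mul hg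
  add_mem' {f g} (hf : ContDiff ℝ ∞ f) (hg : ContDiff ℝ ∞ g) := hf.add hg
  algebraMap_mem' c := (contDiff_const : ContDiff ℝ ∞ fun _ : E => c)

/-- `C^∞(E)`: the smooth complex-valued functions on `E`. -/
def SmoothFn (E : Type*) [NormedAddCommGroup E] [NormedSpace ℝ E] : Type _ :=
  smoothSubalgebra E

section SmoothFn

variable {E F : Type*} [NormedAddCommGroup E] [NormedSpace ℝ E]
  [NormedAddCommGroup F] [NormedSpace ℝ F]

instance : CommRing (SmoothFn E) := inferInstanceAs (CommRing (smoothSubalgebra E))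

instance : Algebra ℂ (SmoothFn E) := inferInstanceAs (Algebra ℂ (smoothSubalgebra E))

instance : CoeFun (SmoothFn E) (fun _ => E → ℂ) := ⟨fun f => f.1⟩

theorem SmoothFn.contDiff (f : SmoothFn E) : ContDiff ℝ ∞ (f : E → ℂ) := f.2

theorem SmoothFn.ext {f g : SmoothFn E} (h : ∀ x, f x = g x) : f = g :=
  Subtype.ext (funext h)

/-- A smooth function, from the function and the proof of smoothness. -/
def SmoothFn.mk (f : E → ℂ) (hf : ContDiff ℝ ∞ f) : SmoothFn E := ⟨f, hf⟩

theorem SmoothFn.mk_apply (f : E → ℂ) (hf : ContDiff ℝ ∞ f) (x : E) :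
    SmoothFn.mk f hf x = f x := rfl

theorem SmoothFn.add_apply (f g : SmoothFn E) (x : E) : (f + g) x = f x + g x := rfl

theorem SmoothFn.smul_apply (c : ℂ) (f : SmoothFn E) (x : E) : (c • f) x = c * f x := rfl

/-- A smooth function regarded as a continuous function. -/
def SmoothFn.toC (f : SmoothFn E) : C(E, ℂ) := ⟨f, f.contDiff.continuous⟩

/-- The directional derivative along `v`. -/
def dirD (v : E) : SmoothFn E →ₗ[ℂ] SmoothFn E where
  toFun f := SmoothFn.mk (fun x => fderiv ℝ (f : E → ℂ) x v)
    ((f.contDiff.fderiv_right (m := ∞) le_rfl).clm_apply contDiff_const)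
  map_add' f g := SmoothFn.ext fun x => by
    change fderiv ℝ ((f : E → ℂ) + (g : E → ℂ)) x v = _
    rw [fderiv_add (f.contDiff.differentiable (by simp) x)
      (g.contDiff.differentiable (by simp) x)]
    rfl
  map_smul' c f := SmoothFn.ext fun x => by
    change fderiv ℝ (c • (f : E → ℂ)) x v = _
    rw [fderiv_const_smul (f.contDiff.differentiable (by simp) x)]
    rfl

theorem dirD_apply (v : E) (f : SmoothFn E) (x : E) :
    dirD v f x = fderiv ℝ (f : E → ℂ) x v := rfl

/-- The iterated directional derivative along the vectors of a list. -/
def iterD : List E → (SmoothFn E →ₗ[ℂ] SmoothFn E)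
  | [] => LinearMap.id
  | v :: l => dirD v ∘ₗ iterD l

/-- The smooth (`C^∞`) topology: uniform convergence on compact sets of all partial derivatives. -/
instance : TopologicalSpace (SmoothFn E) :=
  TopologicalSpace.induced (fun f (l : List E) => (iterD l f).toC) inferInstance

/-- Complex conjugation of functions. -/
def SmoothFn.conj (f : SmoothFn E) : SmoothFn E :=
  SmoothFn.mk (fun x => starRingEnd ℂ (f x))
    (Complex.conjCLE.contDiff.comp f.contDiff)

/-- The pull-back `φ^*` along a smooth map. -/
def pullback (φ : E → F) (hφ : ContDiff ℝ ∞ φ) : SmoothFn F →ₗ[ℂ] SmoothFn E where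
  toFun f := SmoothFn.mk (fun x => f (φ x)) (f.contDiff.comp hφ)
  map_add' _ _ := rfl
  map_smul' _ _ := rfl

/-- The function `F (x, ·)`. -/
def slice (G : SmoothFn (E × F)) (x : E) : SmoothFn F :=
  SmoothFn.mk (fun y => G (x, y)) (G.contDiff.comp (contDiff_const.prodMk contDiff_id))

theorem tendsto_iff {α : Type*} {l : Filter α} {u : α → SmoothFn E} {f : SmoothFn E} :
    Tendsto u l (𝓝 f) ↔ ∀ L : List E, Tendsto (fun a => (iterD L (u a)).toC) l
      (𝓝 (iterD L f).toC) := by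
  rw [nhds_induced, tendsto_comap_iff, tendsto_pi_nhds]; rfl

theorem dirD_comm (v w : E) (f : SmoothFn E) : dirD v (dirD w f) = dirD w (dirD v f) := by
  have key : ∀ a b x, fderiv ℝ (fun y => fderiv ℝ (f : E → ℂ) y b) x a
      = fderiv ℝ (fderiv ℝ (f : E → ℂ)) x a b := by
    intro a b x
    have hd : DifferentiableAt ℝ (fderiv ℝ (f : E → ℂ)) x :=
      (f.contDiff.fderiv_right (m := ∞) le_rfl).differentiable (by simp) x
    rw [fderiv_clm_apply hd (differentiableAt_const b)]
    simp
  refine SmoothFn.ext fun x => ?_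
  have hs : IsSymmSndFDerivAt ℝ (f : E → ℂ) x :=
    f.contDiff.contDiffAt.isSymmSndFDerivAt (by
      rw [minSmoothness_of_isRCLikeNormedField]
      exact ENat.LEInfty.out)
  exact (key v w x).trans ((hs v w).trans (key w v x).symm)

theorem dirD_iterD (v : E) (l : List E) (f : SmoothFn E) :
    iterD l (dirD v f) = dirD v (iterD l f) := by
  induction l with
  | nil => rfl
  | cons w l ih =>
    change dirD w (iterD l (dirD v f)) = dirD v (dirD w (iterD l f))
    rw [ih, dirD_comm]

theorem dirD_slice (w : F) (G : SmoothFn (E × F)) (x : E) :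
    dirD w (slice G x) = slice (dirD ((0, w) : E × F) G) x := by
  refine SmoothFn.ext fun y => ?_
  have h1 : HasFDerivAt (G : E × F → ℂ) (fderiv ℝ (G : E × F → ℂ) (x, y)) (x, y) :=
    (G.contDiff.differentiable (by simp) _).hasFDerivAt
  have h2 := h1.comp y (hasFDerivAt_prodMk_right x y)
  have h3 : fderiv ℝ (slice G x : F → ℂ) y = _ := h2.fderiv
  rw [dirD_apply, h3]
  rfl

theorem iterD_slice (l : List F) (G : SmoothFn (E × F)) (x : E) :
    iterD l (slice G x) = slice (iterD (l.map fun w => ((0, w) : E × F)) G) x := by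
  induction l with
  | nil => rfl
  | cons w l ih =>
    change dirD w (iterD l (slice G x)) = _
    rw [ih, dirD_slice]
    rfl

theorem continuous_slice (G : SmoothFn (E × F)) : Continuous (slice G) := by
  rw [continuous_iff_continuousAt]
  intro x
  refine tendsto_iff.2 fun l => ?_
  simp only [iterD_slice]
  refine Continuous.tendsto (f := fun a => (slice (iterD (l.map fun w => ((0, w) : E × F)) G) a).toC)
    (ContinuousMap.continuous_of_continuous_uncurry _ ?_) x
  exact (SmoothFn.contDiff _).continuous

/-- Difference quotients of the slices of `G` converge in the smooth topology. -/
theorem tendsto_slope_slice (G : SmoothFn (E × F)) (x v : E) :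
    Tendsto (fun h : ℝ => ((h⁻¹ : ℝ) : ℂ) • (slice G (x + h • v) - slice G x)) (𝓝[≠] 0)
      (𝓝 (slice (dirD ((v, 0) : E × F) G) x)) := by
  refine tendsto_iff.2 fun l => ?_
  simp only [map_smul, map_sub, iterD_slice, dirD_iterD]
  generalize iterD (l.map fun w => ((0, w) : E × F)) G = K
  set D := dirD ((v, 0) : E × F) K with hD
  -- the Hadamard quotient
  have hc : Continuous (Function.uncurry fun (p : ℝ × F) (s : ℝ) =>
      D (x + (s * p.1) • v, p.2)) := by
    refine D.contDiff.continuous.comp ?_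
    fun_prop
  have hI := intervalIntegral.continuous_parametric_intervalIntegral_of_continuous'
    (μ := MeasureTheory.volume) hc 0 1
  let Q : ℝ → C(F, ℂ) := ContinuousMap.curry ⟨_, hI⟩
  have hQ : Continuous Q := (ContinuousMap.curry ⟨_, hI⟩).continuous
  have hQ0 : Q 0 = (slice D x).toC := by
    ext y
    change (∫ s in (0:ℝ)..1, D (x + (s * 0) • v, y)) = D (x, y)
    simp
  have hev : ∀ h : ℝ, h ≠ 0 →
      (((h⁻¹ : ℝ) : ℂ) • (slice K (x + h • v) - slice K x)).toC = Q h := by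
    intro h hh
    ext y
    change ((h⁻¹ : ℝ) : ℂ) * (K (x + h • v, y) - K (x, y)) = ∫ s in (0:ℝ)..1, D (x + (s * h) • v, y)
    have hder : ∀ s ∈ Set.uIcc (0:ℝ) 1, HasDerivAt (fun s : ℝ => K (x + (s * h) • v, y))
        ((h : ℂ) * D (x + (s * h) • v, y)) s := by
      intro s _
      have h1 : HasFDerivAt (K : E × F → ℂ) _ (x + (s * h) • v, y) :=
        (K.contDiff.differentiable (by simp) _).hasFDerivAt
      have h2 : HasDerivAt (fun s : ℝ => (x + (s * h) • v, y)) (h • ((v, 0) : E × F)) s := by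
        have := ((((hasDerivAt_id s).mul_const h).smul_const v).const_add x).prodMk
          (hasDerivAt_const s y)
        simpa using this
      have h3 := h1.comp_hasDerivAt s h2
      rw [map_smul, Complex.real_smul] at h3
      exact h3
    have hcont : Continuous fun s : ℝ => (h : ℂ) * D (x + (s * h) • v, y) := by
      refine continuous_const.mul (D.contDiff.continuous.comp ?_)
      fun_prop
    have := intervalIntegral.integral_eq_sub_of_hasDerivAt hder (hcont.intervalIntegrable 0 1)
    rw [intervalIntegral.integral_const_mul] at this
    simp only [one_mul, zero_mul, zero_smul, add_zero] at this
    rw [← this, ← mul_assoc]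
    push_cast
    rw [inv_mul_cancel₀ (by exact_mod_cast hh), one_mul]
  rw [← hQ0]
  refine ((hQ.tendsto 0).mono_left nhdsWithin_le_nhds).congr' ?_
  filter_upwards [self_mem_nhdsWithin] with h hh
  exact (hev h hh).symm

theorem hasFDerivAt_of_line {g : E → ℂ} {g' : E → E →L[ℝ] ℂ} (hg' : Continuous g')
    (h : ∀ x v : E, HasDerivAt (fun t : ℝ => g (x + t • v)) (g' x v) 0) (x : E) :
    HasFDerivAt g (g' x) x := by
  have hline : ∀ v : E, ∀ t : ℝ, HasDerivAt (fun t : ℝ => g (x + t • v)) (g' (x + t • v) v) t := by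
    intro v t
    have h1 := h (x + t • v) v
    have h2 : HasDerivAt (fun s : ℝ => s - t) 1 t := (hasDerivAt_id t).sub_const t
    have h3 := HasDerivAt.scomp (h := fun s : ℝ => s - t) t (by rwa [sub_self]) h2
    simp only [one_smul] at h3
    refine h3.congr_of_eventuallyEq (Eventually.of_forall fun s => ?_)
    simp only [Function.comp_apply]
    congr 1
    module
  rw [hasFDerivAt_iff_isLittleO_nhds_zero, Asymptotics.isLittleO_iff]
  intro ε hε
  obtain ⟨δ, hδ, hball⟩ := Metric.continuousAt_iff.1 hg'.continuousAt ε hε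
  filter_upwards [Metric.ball_mem_nhds (0 : E) hδ] with v hv
  have hv' : ‖v‖ < δ := by simpa using hv
  have hb := norm_image_sub_le_of_norm_deriv_le_segment_01'
    (f := fun t : ℝ => g (x + t • v) - t • g' x v) (f' := fun t => g' (x + t • v) v - g' x v)
    (C := ε * ‖v‖) (fun t _ => by
      have := (hline v t).sub ((hasDerivAt_id t).smul_const (g' x v))
      simp only [one_smul, id] at this
      exact this.hasDerivWithinAt) (fun t ht => by
      rw [← sub_apply]
      refine (ContinuousLinearMap.le_opNorm _ _).trans ?_
      gcongr
      have : dist (x + t • v) x < δ := by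
        rw [dist_eq_norm, add_sub_cancel_left, norm_smul, Real.norm_of_nonneg ht.1]
        have : t * ‖v‖ ≤ 1 * ‖v‖ := by gcongr; exact ht.2.le
        linarith
      have := hball this
      rw [dist_eq_norm] at this
      exact this.le)
  simpa [sub_right_comm] using hb

theorem contDiff_slice [FiniteDimensional ℝ E] (lam : SmoothFn F →ₗ[ℂ] ℂ) (hlam : Continuous lam)
    (G : SmoothFn (E × F)) : ContDiff ℝ ∞ fun x => lam (slice G x) := by
  rw [contDiff_infty]
  intro n
  induction n generalizing G with
  | zero => exact contDiff_zero.2 (hlam.comp (continuous_slice G))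
  | succ n ih =>
    let g' : E → E →L[ℝ] ℂ := fun x => LinearMap.toContinuousLinearMap
      { toFun := fun v => lam (slice (dirD ((v, 0) : E × F) G) x)
        map_add' := fun v w => by
          rw [← map_add]
          congr 1
          refine SmoothFn.ext fun y => ?_
          change fderiv ℝ (G : E × F → ℂ) (x, y) (v + w, 0) =
            fderiv ℝ (G : E × F → ℂ) (x, y) (v, 0) + fderiv ℝ (G : E × F → ℂ) (x, y) (w, 0)
          rw [← map_add]; simp
        map_smul' := fun c v => by
          rw [RingHom.id_apply, Complex.real_smul, ← smul_eq_mul, ← map_smul]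
          congr 1
          refine SmoothFn.ext fun y => ?_
          change fderiv ℝ (G : E × F → ℂ) (x, y) (c • v, 0) =
            (c : ℂ) * fderiv ℝ (G : E × F → ℂ) (x, y) (v, 0)
          rw [← Complex.real_smul, ← map_smul]; simp }
    have hg' : ContDiff ℝ n g' := contDiff_clm_apply_iff.2 fun v => ih (dirD ((v, 0) : E × F) G)
    rw [Nat.cast_succ, contDiff_succ_iff_hasFDerivAt]
    refine ⟨g', hg', hasFDerivAt_of_line hg'.continuous fun x v => ?_⟩
    rw [hasDerivAt_iff_tendsto_slope_zero]
    refine ((hlam.tendsto _).comp (tendsto_slope_slice G x v)).congr fun h => ?_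
    simp [map_smul, map_sub]

/-- The map `id ⊗ lam : C^∞(E × F) → C^∞(E)` for a continuous linear functional `lam`
on `C^∞(F)`: the functional is applied to the second variable. -/
def idTensor [FiniteDimensional ℝ E] (lam : SmoothFn F →ₗ[ℂ] ℂ) (hlam : Continuous lam) :
    SmoothFn (E × F) →ₗ[ℂ] SmoothFn E where
  toFun G := SmoothFn.mk (fun x => lam (slice G x)) (contDiff_slice lam hlam G)
  map_add' G K := SmoothFn.ext fun x => lam.map_add (slice G x) (slice K x)
  map_smul' c G := SmoothFn.ext fun x => lam.map_smul c (slice G x)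

end SmoothFn

section FormalSeries

open PowerSeries Finset.HasAntidiagonal

variable {V W : Type*} [CommRing V] [Algebra ℂ V] [CommRing W] [Algebra ℂ W]

theorem sum_triple_assoc {W : Type*} [AddCommMonoid W] (f : ℕ → ℕ → ℕ → W) (n : ℕ) :
    ∑ p ∈ antidiagonal n, ∑ q ∈ antidiagonal p.2, f p.1 q.1 q.2 =
      ∑ p ∈ antidiagonal n, ∑ q ∈ antidiagonal p.1, f q.1 q.2 p.2 := by
  simp only [Finset.sum_sigma']
  apply Finset.sum_nbij' (fun x => ⟨(x.1.1 + x.2.1, x.2.2), (x.1.1, x.2.1)⟩)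
    (fun x => ⟨(x.2.1, x.2.2 + x.1.2), (x.2.2, x.1.2)⟩) <;> grind [mem_antidiagonal]

theorem sum_triple_comm {W : Type*} [AddCommMonoid W] (f : ℕ → ℕ → ℕ → W) (n : ℕ) :
    ∑ p ∈ antidiagonal n, ∑ q ∈ antidiagonal p.2, f p.1 q.1 q.2 =
      ∑ p ∈ antidiagonal n, ∑ q ∈ antidiagonal p.2, f q.1 p.1 q.2 := by
  rw [sum_triple_assoc, sum_triple_assoc fun a b c => f b a c]
  refine Finset.sum_congr rfl fun p _ => ?_
  rw [← Finset.Nat.sum_antidiagonal_swap]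
  rfl

theorem coeff_formal_smul (a : ℂ⟦X⟧) (f : V⟦X⟧) (n : ℕ) :
    coeff n (a • f) = ∑ p ∈ antidiagonal n, coeff p.1 a • coeff p.2 f := by
  rw [Algebra.smul_def, algebraMap_apply'', coeff_mul]
  exact Finset.sum_congr rfl fun p _ => by rw [coeff_map, Algebra.smul_def]

/-- The formal series `∑ ħ^r T_r` of linear maps `T_r : V → W`, acting `ℂ[[ħ]]`-linearly
from `V[[ħ]]` to `W[[ħ]]`. The formal parameter `ħ` is the variable `X` of the power series. -/
def formalOp (T : ℕ → V →ₗ[ℂ] W) : V⟦X⟧ →ₗ[ℂ⟦X⟧] W⟦X⟧ where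
  toFun f := PowerSeries.mk fun n => ∑ p ∈ antidiagonal n, T p.1 (coeff p.2 f)
  map_add' f g := by
    ext n
    simp [Finset.sum_add_distrib]
  map_smul' a f := by
    ext n
    simp only [coeff_mk, coeff_formal_smul, RingHom.id_apply, map_sum, map_smul, Finset.smul_sum]
    exact sum_triple_comm (fun i j k => coeff j a • T i (coeff k f)) n

theorem coeff_formalOp (T : ℕ → V →ₗ[ℂ] W) (f : V⟦X⟧) (n : ℕ) :
    coeff n (formalOp T f) = ∑ p ∈ antidiagonal n, T p.1 (coeff p.2 f) := by
  simp [formalOp]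

/-- The extension of a linear map `T : V → W` to formal series, order by order in `ħ`. -/
def liftOp (T : V →ₗ[ℂ] W) : V⟦X⟧ →ₗ[ℂ⟦X⟧] W⟦X⟧ := formalOp (Pi.single 0 T)

theorem coeff_liftOp (T : V →ₗ[ℂ] W) (f : V⟦X⟧) (n : ℕ) :
    coeff n (liftOp T f) = T (coeff n f) := by
  rw [liftOp, coeff_formalOp, Finset.sum_eq_single (0, n)]
  · simp
  · rintro ⟨a, b⟩ hab hne
    have : a ≠ 0 := by
      rintro rfl
      simp at hab
      exact hne (by rw [hab])
    simp [this]
  · simp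

/-- The map `exp (ħ D) = ∑ ħ^r D^r / r!`. -/
def expOp (D : Module.End ℂ V) : V⟦X⟧ →ₗ[ℂ⟦X⟧] V⟦X⟧ :=
  formalOp fun r => ((r.factorial : ℂ)⁻¹) • D ^ r

theorem expOp_neg_comp (D : Module.End ℂ V) (f : V⟦X⟧) : expOp (-D) (expOp D f) = f := by
  ext n
  simp only [expOp, coeff_formalOp, map_sum]
  rw [sum_triple_assoc fun i j k => (((i.factorial : ℂ)⁻¹) • (-D) ^ i)
    ((((j.factorial : ℂ)⁻¹) • D ^ j) (coeff k f))]
  rw [Finset.sum_eq_single (0, n)]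
  · simp
  · rintro ⟨a, b⟩ hab hne
    have ha : a ≠ 0 := by
      rintro rfl
      simp at hab
      exact hne (by rw [hab])
    have key : (∑ q ∈ antidiagonal a, ((q.1.factorial : ℂ)⁻¹ * (q.2.factorial : ℂ)⁻¹) •
        ((-D) ^ q.1 * D ^ q.2)) = 0 := by
      have h1 := (Commute.neg_left (Commute.refl D)).add_pow' a
      rw [neg_add_cancel, zero_pow ha] at h1
      have h2 := congrArg (fun z => ((a.factorial : ℂ)⁻¹) • z) h1
      simp only [smul_zero, Finset.smul_sum] at h2
      rw [h2]
      refine Finset.sum_congr rfl fun q hq => ?_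
      rw [mem_antidiagonal] at hq
      rw [← Nat.cast_smul_eq_nsmul ℂ, smul_smul]
      congr 1
      subst hq
      rw [Nat.cast_add_choose]
      have := Nat.cast_ne_zero (R := ℂ).2 (Nat.factorial_ne_zero (q.1 + q.2))
      field_simp
    have := congrArg (fun L : Module.End ℂ V => L (coeff b f)) key
    simp only [LinearMap.zero_apply, LinearMap.sum_apply] at this
    rw [← this]
    refine Finset.sum_congr rfl fun q _ => ?_
    simp [smul_smul, mul_comm]
  · simp

/-- `exp (ħ D)` as a linear equivalence, with inverse `exp (-ħ D)`. -/
def expEquiv (D : Module.End ℂ V) : V⟦X⟧ ≃ₗ[ℂ⟦X⟧] V⟦X⟧ :=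
  LinearEquiv.ofLinearMap (expOp D) (expOp (-D))
    (LinearMap.ext fun f => by simpa using expOp_neg_comp (-D) f)
    (LinearMap.ext fun f => expOp_neg_comp D f)

end FormalSeries

section Deformation

open PowerSeries Finset.HasAntidiagonal

variable {E : Type*} [NormedAddCommGroup E] [NormedSpace ℝ E] {ι : Type*} [Fintype ι]

/-- The operator `C_r` of the Weyl-Moyal star product. The vectors `eq i` and `ep i` are the
coordinate directions of the canonical coordinates `q_i` and `p_i`. -/
def weylC (eq ep : ι → E) (r : ℕ) (f g : SmoothFn E) : SmoothFn E :=
  ∑ l ∈ Finset.range (r + 1),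
    ((-(Complex.I / 2)) ^ (r - l) * (Complex.I / 2) ^ l *
        ((l.factorial : ℂ) * ((r - l).factorial : ℂ))⁻¹) •
      ∑ i : Fin r → ι,
        iterD (List.ofFn fun k : Fin r => if (k : ℕ) < l then eq (i k) else ep (i k)) f *
          iterD (List.ofFn fun k : Fin r => if (k : ℕ) < l then ep (i k) else eq (i k)) g

/-- The Weyl-Moyal star product on `C^∞(E)[[ħ]]`. -/
def weylStar (eq ep : ι → E) (f g : (SmoothFn E)⟦X⟧) : (SmoothFn E)⟦X⟧ :=
  PowerSeries.mk fun n => ∑ x ∈ antidiagonal n, ∑ y ∈ antidiagonal x.2,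
    weylC eq ep x.1 (coeff y.1 f) (coeff y.2 g)

/-- Complex conjugation on `C^∞(E)[[ħ]]`, where `ħ` is real. -/
def formalConj (f : (SmoothFn E)⟦X⟧) : (SmoothFn E)⟦X⟧ :=
  PowerSeries.mk fun n => (coeff n f).conj

/-- A formal series in `ℂ[[ħ]]` is `≥ 0` if it is zero, or if it is real and its lowest non-zero
coefficient is positive. -/
def FormalNonneg (a : ℂ⟦X⟧) : Prop :=
  a = 0 ∨ (∀ n, (coeff n a).im = 0) ∧
    ∃ n, (∀ k < n, coeff k a = 0) ∧ 0 < (coeff n a).re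

/-- The linear map `om_r` in `om = ∑ ħ^r om_r`. -/
def orderPart (om : (SmoothFn E)⟦X⟧ →ₗ[ℂ⟦X⟧] ℂ⟦X⟧) (r : ℕ) : SmoothFn E →ₗ[ℂ] ℂ where
  toFun f := coeff r (om (C f))
  map_add' f g := by simp
  map_smul' c f := by
    have : (C (c • f) : (SmoothFn E)⟦X⟧) = (C c : ℂ⟦X⟧) • C f := by
      rw [Algebra.smul_def c f, map_mul, Algebra.smul_def (C c : ℂ⟦X⟧), algebraMap_apply'', map_C]
    rw [this, map_smul, smul_eq_mul, coeff_C_mul, RingHom.id_apply, smul_eq_mul]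

/-- The derivative at time `t` of a curve in `C^∞(E)[[ħ]]` is `g`: order by order in `ħ`, the
difference quotients converge in the smooth topology. -/
def HasFormalDerivAt (γ : ℝ → (SmoothFn E)⟦X⟧) (g : (SmoothFn E)⟦X⟧) (t : ℝ) : Prop :=
  ∀ n, Tendsto (fun h : ℝ => ((h⁻¹ : ℝ) : ℂ) • (coeff n (γ (t + h)) - coeff n (γ t))) (𝓝[≠] 0)
    (𝓝 (coeff n g))

/-- The Heisenberg equation `dγ/dt = (i/ħ) [H, γ]_⋆`, with the division by `ħ` written as a
multiplication on the other side. -/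
def HeisenbergEq (star : (SmoothFn E)⟦X⟧ → (SmoothFn E)⟦X⟧ → (SmoothFn E)⟦X⟧)
    (H : (SmoothFn E)⟦X⟧) (γ : ℝ → (SmoothFn E)⟦X⟧) : Prop :=
  ∀ t, ∃ g, HasFormalDerivAt γ g t ∧ X * g = Complex.I • (star H (γ t) - star (γ t) H)

/-- `A` is the quantum time evolution for `H`: for every `f`, the curve `t ↦ A t f` is the unique
solution of the Heisenberg equation with initial value `f`. -/
def IsQuantumEvolution (star : (SmoothFn E)⟦X⟧ → (SmoothFn E)⟦X⟧ → (SmoothFn E)⟦X⟧)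
    (H : (SmoothFn E)⟦X⟧) (A : ℝ → (SmoothFn E)⟦X⟧ →ₗ[ℂ⟦X⟧] (SmoothFn E)⟦X⟧) : Prop :=
  ∀ f, ∀ γ : ℝ → (SmoothFn E)⟦X⟧, (γ 0 = f ∧ HeisenbergEq star H γ) ↔ ∀ t, γ t = A t f

/-- The Hamiltonian vector field `X_H = {·, H}` of the canonical Poisson structure, in the
canonical coordinates with directions `eq i`, `ep i`. -/
def hamVectorField (eq ep : ι → E) (H : E → ℝ) (x : E) : E :=
  ∑ i, ((fderiv ℝ H x (ep i)) • eq i - (fderiv ℝ H x (eq i)) • ep i)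

/-- `Φ` is the (complete) flow of the vector field `v`. -/
def IsFlow (v : E → E) (Φ : ℝ → E → E) : Prop :=
  ∀ x, Φ 0 x = x ∧ ∀ t, HasDerivAt (fun s => Φ s x) (v (Φ t x)) t

end Deformation

section Oscillators

open PowerSeries

/-- The phase space `ℝ²` of one oscillator, with points `(q, p)`. -/
abbrev Phase := ℝ × ℝ

/-- The phase space of the total system: pairs of a point `(q_S, p_S)` of the system and a point
`(q_B, p_B)` of the bath. -/
abbrev TotalPhase := Phase × Phase

/-- The Weyl-Moyal star product on the phase space of a single oscillator. -/
def starOne : (SmoothFn Phase)⟦X⟧ → (SmoothFn Phase)⟦X⟧ → (SmoothFn Phase)⟦X⟧ :=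
  weylStar (ι := Fin 1) (fun _ => (1, 0)) (fun _ => (0, 1))

/-- The directions of the coordinates `q_S, q_B`. -/
def dirQ : Fin 2 → TotalPhase := ![((1, 0), (0, 0)), ((0, 0), (1, 0))]

/-- The directions of the coordinates `p_S, p_B`. -/
def dirP : Fin 2 → TotalPhase := ![((0, 1), (0, 0)), ((0, 0), (0, 1))]

/-- The Weyl-Moyal star product on the total system. -/
def starTotal :
    (SmoothFn TotalPhase)⟦X⟧ → (SmoothFn TotalPhase)⟦X⟧ → (SmoothFn TotalPhase)⟦X⟧ :=
  weylStar dirQ dirP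

/-- The Hamiltonian `p² / (2m) + m ν² q² / 2` of a harmonic oscillator. -/
def hamOne (m ν : ℝ) (x : Phase) : ℝ := 1 / (2 * m) * x.2 ^ 2 + m * ν ^ 2 / 2 * x.1 ^ 2

/-- The total Hamiltonian `H_S + H_B + κ/2 (q_S - q_B)²`. -/
def hamTotal (m ν κ : ℝ) (x : TotalPhase) : ℝ :=
  hamOne m ν x.1 + hamOne m ν x.2 + κ / 2 * (x.1.1 - x.2.1) ^ 2

/-- The total Hamiltonian as an element of `C^∞[[ħ]]`. -/
def hamFormal (m ν κ : ℝ) : (SmoothFn TotalPhase)⟦X⟧ :=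
  C (SmoothFn.mk (fun x => (hamTotal m ν κ x : ℂ)) (by
    have h : ContDiff ℝ ∞ (hamTotal m ν κ) := by
      unfold hamTotal hamOne
      fun_prop
    exact Complex.ofRealCLM.contDiff.comp h))

/-- The frequency `ν_κ`, with `ν_κ² = ν² + 2κ/m`. -/
def freq (m ν κ : ℝ) : ℝ := √(ν ^ 2 + 2 * κ / m)

/-- The classical time evolution `Φ_t` of the total system. -/
def flow (m ν κ t : ℝ) (x : TotalPhase) : TotalPhase :=
  let μ := freq m ν κ
  let a := Real.cos (ν * t) + Real.cos (μ * t)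
  let a' := Real.cos (ν * t) - Real.cos (μ * t)
  let b := Real.sin (ν * t) / (m * ν) + Real.sin (μ * t) / (m * μ)
  let b' := Real.sin (ν * t) / (m * ν) - Real.sin (μ * t) / (m * μ)
  let c := -m * (ν * Real.sin (ν * t) + μ * Real.sin (μ * t))
  let c' := -m * (ν * Real.sin (ν * t) - μ * Real.sin (μ * t))
  (((a * x.1.1 + b * x.1.2 + a' * x.2.1 + b' * x.2.2) / 2,
    (c * x.1.1 + a * x.1.2 + c' * x.2.1 + a' * x.2.2) / 2),
   ((a' * x.1.1 + b' * x.1.2 + a * x.2.1 + b * x.2.2) / 2,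
    (c' * x.1.1 + a' * x.1.2 + c * x.2.1 + a * x.2.2) / 2))

theorem contDiff_flow (m ν κ t : ℝ) : ContDiff ℝ ∞ (flow m ν κ t) := by
  unfold flow
  fun_prop

/-- The pull-back `Φ_t^*` on `C^∞[[ħ]]`. -/
def flowPull (m ν κ t : ℝ) :
    (SmoothFn TotalPhase)⟦X⟧ →ₗ[ℂ⟦X⟧] (SmoothFn TotalPhase)⟦X⟧ :=
  liftOp (pullback (flow m ν κ t) (contDiff_flow m ν κ t))

/-- The pull-back `pr_S^*` along the projection to the system. -/
def prSys : (SmoothFn Phase)⟦X⟧ →ₗ[ℂ⟦X⟧] (SmoothFn TotalPhase)⟦X⟧ :=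
  liftOp (pullback (Prod.fst : TotalPhase → Phase) contDiff_fst)

/-- The frequencies `ν_1 = ν` and `ν_2 = ν_κ` of the normal modes. -/
def modeFreq (m ν κ : ℝ) : Fin 2 → ℝ := ![ν, freq m ν κ]

/-- The direction of the normal coordinate `q_1 = (q_S + q_B)/√2`, resp. `q_2 = (q_S - q_B)/√2`,
in the coordinate system `q_1, p_1, q_2, p_2`. -/
def modeQ : Fin 2 → TotalPhase :=
  ![(1 / √2 : ℝ) • (dirQ 0 + dirQ 1), (1 / √2 : ℝ) • (dirQ 0 - dirQ 1)]

/-- The direction of the normal coordinate `p_1 = (p_S + p_B)/√2`, resp. `p_2 = (p_S - p_B)/√2`,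
in the coordinate system `q_1, p_1, q_2, p_2`. -/
def modeP : Fin 2 → TotalPhase :=
  ![(1 / √2 : ℝ) • (dirP 0 + dirP 1), (1 / √2 : ℝ) • (dirP 0 - dirP 1)]

/-- The operator `∂/∂z_k`, where `z_k = √(m ν_k) q_k + i p_k / √(m ν_k)`. -/
def dZ (m ν κ : ℝ) (k : Fin 2) : Module.End ℂ (SmoothFn TotalPhase) :=
  (1 / (2 * (√(m * modeFreq m ν κ k) : ℝ)) : ℂ) • dirD (modeQ k) +
    (((√(m * modeFreq m ν κ k) : ℝ) : ℂ) / (2 * Complex.I)) • dirD (modeP k)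

/-- The operator `∂/∂z̄_k`, where `z̄_k = √(m ν_k) q_k - i p_k / √(m ν_k)`. -/
def dZbar (m ν κ : ℝ) (k : Fin 2) : Module.End ℂ (SmoothFn TotalPhase) :=
  (1 / (2 * (√(m * modeFreq m ν κ k) : ℝ)) : ℂ) • dirD (modeQ k) -
    (((√(m * modeFreq m ν κ k) : ℝ) : ℂ) / (2 * Complex.I)) • dirD (modeP k)

/-- `Δ = ∑_k ∂²/∂z_k ∂z̄_k`. -/
def wickLaplacian (m ν κ : ℝ) : Module.End ℂ (SmoothFn TotalPhase) :=
  ∑ k, dZ m ν κ k ∘ₗ dZbar m ν κ k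

/-- The Wick equivalence `S = exp (ħ Δ)`. -/
def wickS (m ν κ : ℝ) : (SmoothFn TotalPhase)⟦X⟧ ≃ₗ[ℂ⟦X⟧] (SmoothFn TotalPhase)⟦X⟧ :=
  expEquiv (wickLaplacian m ν κ)

/-- A quantum state of the bath (not necessarily normalized): a `ℂ[[ħ]]`-linear functional
`om = ∑ ħ^r om_r` on `C^∞[[ħ]]` that is positive for the Weyl-Moyal star product of the bath and
has continuous `om_r`. -/
structure BathState where
  /-- the underlying functional -/
  toFunctional : (SmoothFn Phase)⟦X⟧ →ₗ[ℂ⟦X⟧] ℂ⟦X⟧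
  /-- each order of the functional is continuous for the smooth topology -/
  continuous_orderPart : ∀ r, Continuous (orderPart toFunctional r)
  /-- positivity -/
  positive : ∀ f, FormalNonneg (toFunctional (starOne (formalConj f) f))

/-- The map `id ⊗ om : C^∞(S × B)[[ħ]] → C^∞(S)[[ħ]]`, defined order by order in `ħ`. -/
def BathState.idTensor (om : BathState) :
    (SmoothFn TotalPhase)⟦X⟧ →ₗ[ℂ⟦X⟧] (SmoothFn Phase)⟦X⟧ :=
  formalOp fun r => OpenOsc.idTensor (orderPart om.toFunctional r) (om.continuous_orderPart r)

/-- The quantized open time evolution `(id ⊗ om) ∘ A_t ∘ pr_S^*` for the total time evolution `A`. -/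
def openEvolution (A : ℝ → (SmoothFn TotalPhase)⟦X⟧ →ₗ[ℂ⟦X⟧] (SmoothFn TotalPhase)⟦X⟧)
    (om : BathState) (t : ℝ) : (SmoothFn Phase)⟦X⟧ →ₗ[ℂ⟦X⟧] (SmoothFn Phase)⟦X⟧ :=
  om.idTensor ∘ₗ A t ∘ₗ prSys

end Oscillators

end OpenOsc

end

open scoped PowerSeries
open OpenOsc

namespace OpenOsc

/-! ### Commuting derivatives, the Moyal commutator with a quadratic function, evaluation along
curves. -/

section General

open PowerSeries Finset.HasAntidiagonal

variable {E : Type*} [NormedAddCommGroup E] [NormedSpace ℝ E]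

/-! The Hamiltonian is quadratic, so `(i/ħ)[H, ·]` is exactly the Poisson bracket: the even orders
of the Moyal product are symmetric and cancel (`weylC_swap`), and the orders from three on contain
third derivatives of `H`. At each order in `ħ` the Heisenberg equation is therefore the transport
equation `u' = {u, H}`. By the method of characteristics its only solution is the pull-back of the
initial value along the classical flow (`tendsto_slope_flowPb`, `eq_flowPb_of_tendsto_slope`), so
the quantum evolution is `Φ_t^*` itself.

Conjugation by `S` changes nothing: in normal modes the flow multiplies `∂/∂z_k` and `∂/∂z̄_k` by
inverse phases, so `Φ_t^*` commutes with `Δ` (`commute_flowPb_wickLaplacian`), and hence with `exp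
(ħ Δ)`. The open evolution follows by substitution. -/

theorem fderiv_apply_eq_of_hasDerivAt_line {F : Type*} [NormedAddCommGroup F] [NormedSpace ℝ F]
    {f : E → F} {x v : E} {c : F} (hf : DifferentiableAt ℝ f x)
    (h : HasDerivAt (fun t : ℝ => f (x + t • v)) c 0) : fderiv ℝ f x v = c := by
  rw [← hf.lineDeriv_eq_fderiv]
  exact h.deriv

theorem dirD_eq_of_hasDerivAt_line {f g : SmoothFn E} {v : E}
    (h : ∀ x, HasDerivAt (fun t : ℝ => f (x + t • v)) (g x) 0) : dirD v f = g :=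
  SmoothFn.ext fun x =>
    fderiv_apply_eq_of_hasDerivAt_line (f.contDiff.differentiable (by simp) x) (h x)

theorem dirD_add_left (v w : E) (f : SmoothFn E) : dirD (v + w) f = dirD v f + dirD w f :=
  SmoothFn.ext fun x => (fderiv ℝ (f : E → ℂ) x).map_add v w

theorem dirD_smul_left (c : ℝ) (v : E) (f : SmoothFn E) : dirD (c • v) f = (c : ℂ) • dirD v f :=
  SmoothFn.ext fun x => by
    rw [SmoothFn.smul_apply, dirD_apply, dirD_apply, map_smul, Complex.real_smul]

/-- A linear map is its own derivative, so the direction on the right does not depend on the point.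
-/
theorem dirD_pullback (T : E →L[ℝ] E) (hT : ContDiff ℝ ∞ T) (v : E) (f : SmoothFn E) :
    dirD v (pullback T hT f) = pullback T hT (dirD (T v) f) :=
  SmoothFn.ext fun x => by
    have h1 : HasFDerivAt (f : E → ℂ) _ (T x) :=
      (f.contDiff.differentiable (by simp) _).hasFDerivAt
    have h2 : fderiv ℝ (pullback T hT f : E → ℂ) x = _ := (h1.comp x T.hasFDerivAt).fderiv
    rw [dirD_apply, h2]
    rfl

theorem iterD_perm {l l' : List E} (h : l.Perm l') : iterD l = iterD l' := by
  induction h with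
  | nil => rfl
  | cons v _ ih => exact congrArg (dirD v ∘ₗ ·) ih
  | swap v w l => exact LinearMap.ext fun f => dirD_comm w v (iterD l f)
  | trans _ _ ih ih' => exact ih.trans ih'

/-- `weylC` puts one kind of direction in the first `l` slots. Exchanging the factors moves it to
the last slots, and reversal brings it back. -/
theorem iterD_ofFn_rev {r : ℕ} (a : Fin r → E) :
    iterD (List.ofFn fun k => a k.rev) = iterD (List.ofFn a) := by
  refine iterD_perm ?_
  exact Equiv.Perm.ofFn_comp_perm Fin.revPerm a

/-- The order `r` part of the Weyl-Moyal product is symmetric or antisymmetric, according to the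
parity of `r`. -/
theorem weylC_swap {ι : Type*} [Fintype ι] (eq ep : ι → E) (r : ℕ) (f g : SmoothFn E) :
    weylC eq ep r g f = (-1 : ℂ) ^ r • weylC eq ep r f g := by
  unfold weylC
  -- Swapping the factors exchanges the roles of `q` and `p`, so the term `r - l` on one side
  -- matches the term `l` on the other.
  rw [Finset.smul_sum, ← Finset.sum_range_reflect]
  refine Finset.sum_congr rfl fun l hl => ?_
  have hl' : l ≤ r := Nat.lt_succ_iff.1 (Finset.mem_range.1 hl)
  have e1 : r + 1 - 1 - l = r - l := by omega
  have e2 : r - (r - l) = l := by omega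
  rw [e1, e2, smul_smul]
  congr 1
  · rw [neg_pow, neg_pow (Complex.I / 2) (r - l)]
    -- The matched coefficients carry the signs `(-1)^l` and `(-1)^(r-l)`, whose quotient is
    -- `(-1)^r`.
    have : (-1 : ℂ) ^ l = (-1) ^ r * (-1) ^ (r - l) := by
      rw [← pow_add, show r + (r - l) = l + 2 * (r - l) by omega, pow_add, pow_mul]
      simp
    rw [this]
    ring
  · refine Fintype.sum_equiv (Equiv.arrowCongr Fin.revPerm (Equiv.refl ι)) _ _ fun i => ?_
    rw [mul_comm]
    congr 2
    · rw [← iterD_ofFn_rev]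
      congr 2
      ext1 k
      -- Reversal sends slot `k` to `r - 1 - k`, which is below `r - l` exactly when `k ≥ l`.
      have : (k.rev : ℕ) < r - l ↔ ¬ (k : ℕ) < l := by rw [Fin.val_rev]; omega
      simp only [this, Equiv.arrowCongr_apply, Equiv.coe_refl, Function.comp_apply, id]
      split_ifs <;> rfl
    · rw [← iterD_ofFn_rev]
      congr 2
      ext1 k
      have : (k.rev : ℕ) < r - l ↔ ¬ (k : ℕ) < l := by rw [Fin.val_rev]; omega
      simp only [this, Equiv.arrowCongr_apply, Equiv.coe_refl, Function.comp_apply, id]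
      split_ifs <;> rfl

/-- Directional derivatives commute, so three of them can be made to act on `H` first. -/
theorem iterD_eq_zero_of_quadratic {H : SmoothFn E}
    (hH : ∀ u v w : E, dirD u (dirD v (dirD w H)) = 0) {l : List E} (hl : 3 ≤ l.length) :
    iterD l H = 0 := by
  match l, hl with
  | u :: v :: w :: l, _ =>
    change dirD u (dirD v (dirD w (iterD l H))) = 0
    rw [← dirD_iterD, ← dirD_iterD, ← dirD_iterD, hH, map_zero]

theorem weylC_eq_zero_of_quadratic {ι : Type*} [Fintype ι] (eq ep : ι → E) {H : SmoothFn E}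
    (hH : ∀ u v w : E, dirD u (dirD v (dirD w H)) = 0) {r : ℕ} (hr : 3 ≤ r) (f : SmoothFn E) :
    weylC eq ep r H f = 0 := by
  refine Finset.sum_eq_zero fun l _ => ?_
  rw [Finset.sum_eq_zero fun i _ => ?_, smul_zero]
  rw [iterD_eq_zero_of_quadratic hH (by simpa using hr), zero_mul]

/-- `C H` is concentrated in order zero, which collapses the inner sum of `weylStar`. -/
theorem coeff_weylStar_C_left {ι : Type*} [Fintype ι] (eq ep : ι → E) (H : SmoothFn E)
    (f : (SmoothFn E)⟦X⟧) (n : ℕ) : coeff n (weylStar eq ep (C H) f) =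
      ∑ x ∈ antidiagonal n, weylC eq ep x.1 H (coeff x.2 f) := by
  rw [weylStar, coeff_mk]
  refine Finset.sum_congr rfl fun x _ => ?_
  rw [Finset.sum_eq_single (0, x.2)]
  · simp
  · rintro ⟨a, b⟩ hab hne
    have ha : a ≠ 0 := by
      rintro rfl
      simp at hab
      exact hne (by rw [hab])
    simp [coeff_C, ha, weylC]
  · simp

theorem coeff_weylStar_C_right {ι : Type*} [Fintype ι] (eq ep : ι → E) (H : SmoothFn E)
    (f : (SmoothFn E)⟦X⟧) (n : ℕ) : coeff n (weylStar eq ep f (C H)) =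
      ∑ x ∈ antidiagonal n, weylC eq ep x.1 (coeff x.2 f) H := by
  rw [weylStar, coeff_mk]
  refine Finset.sum_congr rfl fun x _ => ?_
  rw [Finset.sum_eq_single (x.2, 0)]
  · simp
  · rintro ⟨a, b⟩ hab hne
    have ha : b ≠ 0 := by
      rintro rfl
      simp at hab
      exact hne (by rw [hab])
    simp [coeff_C, ha, weylC]
  · simp

/-- The Poisson bracket `{f, H}`. -/
noncomputable def poissonWith {ι : Type*} [Fintype ι] (eq ep : ι → E) (H f : SmoothFn E) : SmoothFn E :=
  ∑ i, (dirD (ep i) H * dirD (eq i) f - dirD (eq i) H * dirD (ep i) f)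

/-- The factor `2i` is the `i` of the Heisenberg equation times the `2` produced by the antisymmetry
of order one. -/
theorem weylC_one {ι : Type*} [Fintype ι] (eq ep : ι → E) (H f : SmoothFn E) :
    (2 * Complex.I) • weylC eq ep 1 H f = poissonWith eq ep H f := by
  have hs : ∀ a : ι → SmoothFn E, ∑ i : Fin 1 → ι, a (i 0) = ∑ i, a i := fun a =>
    Fintype.sum_equiv (Equiv.funUnique (Fin 1) ι) _ _ fun _ => rfl
  have h0 := hs fun i => dirD (ep i) H * dirD (eq i) f
  have h1 := hs fun i => dirD (eq i) H * dirD (ep i) f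
  simp only [weylC, Finset.sum_range_succ, Finset.sum_range_zero, List.ofFn_succ, List.ofFn_zero,
    iterD, poissonWith]
  simp [h0, h1, smul_smul, Finset.sum_sub_distrib]
  have e : 2 * Complex.I * (Complex.I / 2) = -1 := by
    rw [show 2 * Complex.I * (Complex.I / 2) = Complex.I * Complex.I by ring, Complex.I_mul_I]
  rw [e]
  simp [sub_eq_add_neg]

/-- For a quadratic Hamiltonian, `(i/ħ) [H, f]` is the Poisson bracket `{f, H}`. -/
theorem weylStar_commutator_of_quadratic {ι : Type*} [Fintype ι] (eq ep : ι → E) {H : SmoothFn E}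
    (hH : ∀ u v w : E, dirD u (dirD v (dirD w H)) = 0) (f : (SmoothFn E)⟦X⟧) :
    Complex.I • (weylStar eq ep (C H) f - weylStar eq ep f (C H)) =
      X * PowerSeries.mk fun n => poissonWith eq ep H (coeff n f) := by
  -- Only order one survives in the commutator: orders 0 and 2 are symmetric, and higher orders
  -- vanish for quadratic `H`.
  have key : ∀ (r : ℕ) (g : SmoothFn E), r ≠ 1 →
      weylC eq ep r H g - weylC eq ep r g H = 0 := by
    intro r g hr
    rw [weylC_swap eq ep r H g]
    rcases lt_or_ge r 3 with h | h
    · interval_cases r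
      · simp
      · exact absurd rfl hr
      · simp
    · rw [weylC_eq_zero_of_quadratic eq ep hH h, smul_zero, sub_zero]
  ext n : 1
  have hc : coeff n (Complex.I • (weylStar eq ep (C H) f - weylStar eq ep f (C H))) =
      Complex.I • ∑ x ∈ antidiagonal n,
        (weylC eq ep x.1 H (coeff x.2 f) - weylC eq ep x.1 (coeff x.2 f) H) := by
    rw [Finset.sum_sub_distrib, ← coeff_weylStar_C_left, ← coeff_weylStar_C_right]
    rfl
  rw [hc]
  -- The commutator has no order-zero term, so it is divisible by `ħ`. At order `n + 1`, order one
  -- of the product meets coefficient `n` of `f`.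
  cases n with
  | zero => simp [key]
  | succ n =>
    rw [coeff_succ_X_mul, coeff_mk, Finset.sum_eq_single (1, n)]
    · rw [weylC_swap eq ep 1 H, ← weylC_one, mul_comm, mul_smul]
      congr 1
      rw [pow_one, neg_one_smul, sub_neg_eq_add, two_smul]
    · rintro ⟨a, b⟩ hab hne
      refine key a _ ?_
      rintro rfl
      rw [mem_antidiagonal] at hab
      exact hne (by simp; omega)
    · intro h
      exact absurd (mem_antidiagonal.2 (by simp [add_comm])) h

/-- The empty list of derivatives gives convergence in the compact-open topology. -/
theorem tendsto_toC {α : Type*} {l : Filter α} {u : α → SmoothFn E} {f : SmoothFn E}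
    (h : Tendsto u l (𝓝 f)) : Tendsto (fun a => (u a).toC) l (𝓝 f.toC) :=
  tendsto_iff.1 h []

/-- The product rule for `u s (y s)`, where the curve `u` of smooth functions is differentiable in
the smooth topology. -/
theorem hasDerivAt_eval_curve [LocallyCompactSpace E] {u : ℝ → SmoothFn E} {u' : SmoothFn E}
    {y : ℝ → E} {y' : E} {s : ℝ}
    (hu : Tendsto (fun h : ℝ => ((h⁻¹ : ℝ) : ℂ) • (u (s + h) - u s)) (𝓝[≠] 0) (𝓝 u'))
    (hy : HasDerivAt y y' s) :
    HasDerivAt (fun s => u s (y s)) (u' (y s) + dirD y' (u s) (y s)) s := by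
  rw [hasDerivAt_iff_tendsto_slope_zero]
  have hys : Tendsto (fun h => y (s + h)) (𝓝[≠] 0) (𝓝 (y s)) := by
    have := hy.continuousAt.tendsto.comp
      (((continuous_const_add s).tendsto' 0 s (add_zero s)).mono_left
        (nhdsWithin_le_nhds (s := {0}ᶜ)))
    exact this
  -- Evaluation is jointly continuous because `E` is locally compact, so the quotient of `u` may be
  -- evaluated at the moving point `y (s + h)`.
  have h1 := (continuous_eval.tendsto (u'.toC, y s)).comp ((tendsto_toC hu).prodMk_nhds hys)
  have h2 : HasFDerivAt (u s : E → ℂ) _ (y s) :=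
    ((u s).contDiff.differentiable (by simp) _).hasFDerivAt
  have h3 := hasDerivAt_iff_tendsto_slope_zero.1 (h2.comp_hasDerivAt s hy)
  refine (h1.add h3).congr fun h => ?_
  -- The increment is split by inserting `u s (y (s + h))`.
  change ((h⁻¹ : ℝ) : ℂ) * (u (s + h) (y (s + h)) - u s (y (s + h))) +
    h⁻¹ • (u s (y (s + h)) - u s (y s)) = _
  rw [Complex.real_smul, Complex.real_smul]
  ring

end General

/-! ### Operators commuting with a formal exponential. -/

section Mixed

open PowerSeries Finset.HasAntidiagonal

variable {V : Type*} [CommRing V] [Algebra ℂ V]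

theorem liftOp_expOp_of_commute {D T : Module.End ℂ V} (h : Commute T D) (f : V⟦X⟧) :
    liftOp T (expOp D f) = expOp D (liftOp T f) := by
  ext n
  simp only [coeff_liftOp, expOp, coeff_formalOp, map_sum]
  refine Finset.sum_congr rfl fun p _ => ?_
  simp only [LinearMap.smul_apply, map_smul]
  congr 1
  exact LinearMap.congr_fun (h.pow_right p.1) (coeff p.2 f)

end Mixed

/-! ### The quadratic Hamiltonian and its linear vector field. -/

section Oscillators

open PowerSeries

variable (m ν κ : ℝ)

/-- The polarization of `hamTotal`, that is, its derivative at `x` in the direction `v`. -/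
noncomputable def hamPolar (x v : TotalPhase) : ℝ :=
  x.1.2 * v.1.2 / m + x.2.2 * v.2.2 / m + m * ν ^ 2 * (x.1.1 * v.1.1 + x.2.1 * v.2.1) +
    κ * (x.1.1 - x.2.1) * (v.1.1 - v.2.1)

theorem hasDerivAt_quadratic_zero (a b c : ℝ) :
    HasDerivAt (fun t : ℝ => a + t * b + t ^ 2 * c) b 0 := by
  have := (((hasDerivAt_id (0 : ℝ)).mul_const b).const_add a).add
    (((hasDerivAt_id (0 : ℝ)).pow 2).mul_const c)
  exact this.congr_deriv (by simp)

/-- `H` is a homogeneous quadratic form, so `H(x + t v) = H(x) + t B(x, v) + t² H(v)` with `B` its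
polarization. -/
theorem hasDerivAt_hamTotal_line (x v : TotalPhase) :
    HasDerivAt (fun t : ℝ => hamTotal m ν κ (x + t • v)) (hamPolar m ν κ x v) 0 := by
  refine (hasDerivAt_quadratic_zero (hamTotal m ν κ x) _ (hamTotal m ν κ v)).congr_of_eventuallyEq
    (Eventually.of_forall fun t => ?_)
  simp only [hamTotal, hamOne, hamPolar, Prod.fst_add, Prod.snd_add, Prod.smul_fst, Prod.smul_snd,
    smul_eq_mul]
  ring

theorem hasDerivAt_hamPolar_line (x v w : TotalPhase) :
    HasDerivAt (fun t : ℝ => hamPolar m ν κ (x + t • v) w) (hamPolar m ν κ v w) 0 := by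
  refine (hasDerivAt_quadratic_zero (hamPolar m ν κ x w) _ 0).congr_of_eventuallyEq
    (Eventually.of_forall fun t => ?_)
  simp only [hamPolar, Prod.fst_add, Prod.snd_add, Prod.smul_fst, Prod.smul_snd, smul_eq_mul]
  ring

theorem contDiff_hamTotal : ContDiff ℝ ∞ (hamTotal m ν κ) := by
  unfold hamTotal hamOne
  fun_prop

theorem contDiff_hamPolar (v : TotalPhase) : ContDiff ℝ ∞ fun x => hamPolar m ν κ x v := by
  unfold hamPolar
  fun_prop

/-- The total Hamiltonian as a smooth complex-valued function. -/
noncomputable def hamSmooth : SmoothFn TotalPhase :=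
  SmoothFn.mk (fun x => (hamTotal m ν κ x : ℂ))
    (Complex.ofRealCLM.contDiff.comp (contDiff_hamTotal m ν κ))

theorem dirD_hamSmooth (v : TotalPhase) : dirD v (hamSmooth m ν κ) =
    SmoothFn.mk (fun x => (hamPolar m ν κ x v : ℂ))
      (Complex.ofRealCLM.contDiff.comp (contDiff_hamPolar m ν κ v)) :=
  dirD_eq_of_hasDerivAt_line fun x => (hasDerivAt_hamTotal_line m ν κ x v).ofReal_comp

theorem dirD_dirD_dirD_hamSmooth (u v w : TotalPhase) :
    dirD u (dirD v (dirD w (hamSmooth m ν κ))) = 0 := by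
  have h : dirD v (dirD w (hamSmooth m ν κ)) =
      SmoothFn.mk (fun _ => (hamPolar m ν κ v w : ℂ)) contDiff_const := by
    rw [dirD_hamSmooth]
    exact dirD_eq_of_hasDerivAt_line fun x => (hasDerivAt_hamPolar_line m ν κ x v w).ofReal_comp
  rw [h]
  exact dirD_eq_of_hasDerivAt_line fun x => hasDerivAt_const _ _

/-- The Hamiltonian vector field of the coupled oscillators, as a linear map. -/
noncomputable def hamLin : TotalPhase →L[ℝ] TotalPhase :=
  LinearMap.toContinuousLinearMap
    { toFun := fun x =>
        ((x.1.2 / m, -(m * ν ^ 2 * x.1.1 + κ * (x.1.1 - x.2.1))),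
          (x.2.2 / m, -(m * ν ^ 2 * x.2.1 - κ * (x.1.1 - x.2.1))))
      map_add' := fun x y => by
        ext <;> simp only [Prod.fst_add, Prod.snd_add] <;> ring
      map_smul' := fun c x => by
        ext <;> simp only [Prod.smul_fst, Prod.smul_snd, smul_eq_mul, RingHom.id_apply] <;> ring }

theorem hamLin_apply (x : TotalPhase) : hamLin m ν κ x =
    ((x.1.2 / m, -(m * ν ^ 2 * x.1.1 + κ * (x.1.1 - x.2.1))),
      (x.2.2 / m, -(m * ν ^ 2 * x.2.1 - κ * (x.1.1 - x.2.1)))) := rfl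

theorem hamLin_eq_sum (x : TotalPhase) : hamLin m ν κ x =
    ∑ i, (hamPolar m ν κ x (dirP i) • dirQ i - hamPolar m ν κ x (dirQ i) • dirP i) := by
  rw [hamLin_apply, Fin.sum_univ_two]
  ext <;> simp [hamPolar, dirP, dirQ]; ring

theorem hamVectorField_hamTotal :
    hamVectorField dirQ dirP (hamTotal m ν κ) = hamLin m ν κ := by
  ext1 x
  rw [hamLin_eq_sum, hamVectorField]
  simp only [fun v => fderiv_apply_eq_of_hasDerivAt_line
    ((contDiff_hamTotal m ν κ).differentiable (by simp) x) (hasDerivAt_hamTotal_line m ν κ x v)]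

/-- This turns the Heisenberg equation into a transport equation: the bracket with `H`
differentiates along the Hamiltonian vector field. -/
theorem poissonWith_hamSmooth (f : SmoothFn TotalPhase) (x : TotalPhase) :
    poissonWith dirQ dirP (hamSmooth m ν κ) f x = dirD (hamLin m ν κ x) f x := by
  have h : ∀ a b c d : SmoothFn TotalPhase, (a * b - c * d) x = a x * b x - c x * d x :=
    fun _ _ _ _ => rfl
  rw [poissonWith, hamLin_eq_sum, Fin.sum_univ_two, Fin.sum_univ_two, SmoothFn.add_apply, h, h]
  simp only [dirD_hamSmooth, dirD_apply, map_add, map_sub, map_smul, Complex.real_smul]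
  rfl

/-! ### The classical flow and its uniqueness. -/

/-- The flow as a linear map. -/
noncomputable def flowLin (t : ℝ) : TotalPhase →L[ℝ] TotalPhase :=
  LinearMap.toContinuousLinearMap
    { toFun := flow m ν κ t
      map_add' := fun x y => by
        ext <;> simp only [flow, Prod.fst_add, Prod.snd_add] <;> ring
      map_smul' := fun c x => by
        ext <;> simp only [flow, Prod.smul_fst, Prod.smul_snd, smul_eq_mul, RingHom.id_apply] <;>
          ring }

theorem flow_zero (x : TotalPhase) : flow m ν κ 0 x = x := by
  ext <;> simp [flow] <;> ring

variable {m ν κ}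

theorem freq_pos (hm : 0 < m) (hν : 0 < ν) (hκ : 0 < κ) : 0 < freq m ν κ :=
  Real.sqrt_pos.2 (by positivity)

/-- Eliminates `κ` in favour of `ν_κ`, which can then be treated as a free positive variable; no
square root remains in the flow identities. -/
theorem kappa_eq (hm : 0 < m) (hκ : 0 < κ) : κ = m * (freq m ν κ ^ 2 - ν ^ 2) / 2 := by
  rw [freq, Real.sq_sqrt (by positivity)]
  field_simp
  ring

theorem hasDerivAt_flow (hm : 0 < m) (hν : 0 < ν) (hκ : 0 < κ) (t : ℝ) (x : TotalPhase) :
    HasDerivAt (fun s => flow m ν κ s x) (hamLin m ν κ (flow m ν κ t x)) t := by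
  have hμ := freq_pos hm hν hκ
  have hk := kappa_eq (ν := ν) hm hκ
  rw [hamLin_apply]
  simp only [flow]
  generalize freq m ν κ = μ at *
  subst hk
  have hc : ∀ a : ℝ, HasDerivAt (fun s : ℝ => Real.cos (a * s)) (-Real.sin (a * t) * a) t := by
    intro a
    simpa using ((hasDerivAt_id t).const_mul a).cos
  have hs : ∀ a : ℝ, HasDerivAt (fun s : ℝ => Real.sin (a * s)) (Real.cos (a * t) * a) t := by
    intro a
    simpa using ((hasDerivAt_id t).const_mul a).sin
  have ha := (hc ν).add (hc μ)
  have ha' := (hc ν).sub (hc μ)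
  have hb := ((hs ν).div_const (m * ν)).add ((hs μ).div_const (m * μ))
  have hb' := ((hs ν).div_const (m * ν)).sub ((hs μ).div_const (m * μ))
  have hcc := (((hs ν).const_mul ν).add ((hs μ).const_mul μ)).const_mul (-m)
  have hcc' := (((hs ν).const_mul ν).sub ((hs μ).const_mul μ)).const_mul (-m)
  refine HasDerivAt.prodMk (HasDerivAt.prodMk ?_ ?_) (HasDerivAt.prodMk ?_ ?_)
  · refine (((((ha.mul_const x.1.1).add (hb.mul_const x.1.2)).add (ha'.mul_const x.2.1)).add
      (hb'.mul_const x.2.2)).div_const 2).congr_deriv ?_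
    field_simp
    ring
  · refine (((((hcc.mul_const x.1.1).add (ha.mul_const x.1.2)).add (hcc'.mul_const x.2.1)).add
      (ha'.mul_const x.2.2)).div_const 2).congr_deriv ?_
    field_simp
    ring
  · refine (((((ha'.mul_const x.1.1).add (hb'.mul_const x.1.2)).add (ha.mul_const x.2.1)).add
      (hb.mul_const x.2.2)).div_const 2).congr_deriv ?_
    field_simp
    ring
  · refine (((((hcc'.mul_const x.1.1).add (ha'.mul_const x.1.2)).add (hcc.mul_const x.2.1)).add
      (ha.mul_const x.2.2)).div_const 2).congr_deriv ?_
    field_simp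
    ring

/-- The time derivative of `f ∘ Φ_t` differentiates `f` along `X_H (Φ_t x)`, whereas `{f ∘ Φ_t, H}`
gives the direction `Φ_t (X_H x)`. This lemma identifies the two. -/
theorem flow_hamLin (hm : 0 < m) (hν : 0 < ν) (hκ : 0 < κ) (t : ℝ) (x : TotalPhase) :
    flow m ν κ t (hamLin m ν κ x) = hamLin m ν κ (flow m ν κ t x) := by
  have hμ := freq_pos hm hν hκ
  have hk := kappa_eq (ν := ν) hm hκ
  rw [hamLin_apply, hamLin_apply]
  simp only [flow]
  generalize freq m ν κ = μ at *
  subst hk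
  ext <;> dsimp only <;> field_simp <;> ring

theorem isFlow_iff (hm : 0 < m) (hν : 0 < ν) (hκ : 0 < κ) (Ψ : ℝ → TotalPhase → TotalPhase) :
    IsFlow (hamVectorField dirQ dirP (hamTotal m ν κ)) Ψ ↔ Ψ = flow m ν κ := by
  rw [hamVectorField_hamTotal]
  constructor
  · intro h
    funext t x
    -- A linear field is globally Lipschitz, so uniqueness holds for all times.
    have := ODE_solution_unique_univ (v := fun _ => hamLin m ν κ) (s := fun _ => Set.univ) (t₀ := 0)
      (f := fun s => Ψ s x) (g := fun s => flow m ν κ s x)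
      (fun _ => (hamLin m ν κ).lipschitz.lipschitzOnWith)
      (fun s => ⟨(h x).2 s, trivial⟩) (fun s => ⟨hasDerivAt_flow hm hν hκ s x, trivial⟩)
      ((h x).1.trans (flow_zero m ν κ x).symm)
    exact congrFun this t
  · rintro rfl x
    exact ⟨flow_zero m ν κ x, fun t => hasDerivAt_flow hm hν hκ t x⟩

/-! ### The Heisenberg equation as transport along the flow. -/

variable (m ν κ) in
/-- The function `(t, x) ↦ f (Φ_t x)`. -/
noncomputable def flowSmooth (f : SmoothFn TotalPhase) : SmoothFn (ℝ × TotalPhase) :=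
  SmoothFn.mk (fun y => f (flow m ν κ y.1 y.2)) (f.contDiff.comp (by
    unfold flow
    fun_prop))

variable (m ν κ) in
/-- The pull-back along the flow. -/
noncomputable abbrev flowPb (t : ℝ) : Module.End ℂ (SmoothFn TotalPhase) :=
  pullback (flow m ν κ t) (contDiff_flow m ν κ t)

theorem tendsto_slope_flowPb (hm : 0 < m) (hν : 0 < ν) (hκ : 0 < κ) (f : SmoothFn TotalPhase)
    (t : ℝ) :
    Tendsto (fun h : ℝ => ((h⁻¹ : ℝ) : ℂ) • (flowPb m ν κ (t + h) f - flowPb m ν κ t f)) (𝓝[≠] 0)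
      (𝓝 (poissonWith dirQ dirP (hamSmooth m ν κ) (flowPb m ν κ t f))) := by
  -- Joint smoothness in `(t, x)` gives convergence of the quotients in the smooth topology, not
  -- merely pointwise.
  have h := tendsto_slope_slice (flowSmooth m ν κ f) t 1
  have e : slice (dirD ((1, 0) : ℝ × TotalPhase) (flowSmooth m ν κ f)) t =
      poissonWith dirQ dirP (hamSmooth m ν κ) (flowPb m ν κ t f) := by
    refine SmoothFn.ext fun x => ?_
    rw [poissonWith_hamSmooth]
    have e1 : dirD (hamLin m ν κ x) (flowPb m ν κ t f) x =
        dirD (hamLin m ν κ (flow m ν κ t x)) f (flow m ν κ t x) := by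
      rw [← flow_hamLin hm hν hκ]
      exact congrArg (fun g : SmoothFn TotalPhase => g x)
        (dirD_pullback (flowLin m ν κ t) (contDiff_flow m ν κ t) (hamLin m ν κ x) f)
    rw [e1]
    refine fderiv_apply_eq_of_hasDerivAt_line
      ((flowSmooth m ν κ f).contDiff.differentiable (by simp) _) ?_
    have h1 : HasDerivAt (fun s : ℝ => flow m ν κ (t + s) x)
        (hamLin m ν κ (flow m ν κ t x)) 0 := by
      refine HasDerivAt.comp_const_add (f := fun s => flow m ν κ s x) t 0 ?_
      simpa only [add_zero] using hasDerivAt_flow hm hν hκ t x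
    have h2 : HasFDerivAt (f : TotalPhase → ℂ) (fderiv ℝ (f : TotalPhase → ℂ) (flow m ν κ t x))
        (flow m ν κ (t + 0) x) := by
      rw [add_zero]
      exact (f.contDiff.differentiable (by simp) _).hasFDerivAt
    refine (h2.comp_hasDerivAt 0 h1).congr_of_eventuallyEq (Eventually.of_forall fun s => ?_)
    change f (flow m ν κ (t + s • (1 : ℝ)) (x + s • (0 : TotalPhase))) = f (flow m ν κ (t + s) x)
    rw [smul_zero, add_zero, smul_eq_mul, mul_one]
  rw [e] at h
  refine h.congr fun s => ?_
  rw [smul_eq_mul, mul_one]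
  rfl

/-- A curve with derivative `{u, H}` in the smooth topology is the pull-back of its initial value
along the flow. -/
theorem eq_flowPb_of_tendsto_slope (hm : 0 < m) (hν : 0 < ν) (hκ : 0 < κ)
    {u : ℝ → SmoothFn TotalPhase}
    (hu : ∀ s, Tendsto (fun h : ℝ => ((h⁻¹ : ℝ) : ℂ) • (u (s + h) - u s)) (𝓝[≠] 0)
      (𝓝 (poissonWith dirQ dirP (hamSmooth m ν κ) (u s)))) (t : ℝ) :
    u t = flowPb m ν κ t (u 0) := by
  refine SmoothFn.ext fun x => ?_
  -- Method of characteristics: `s ↦ u s (Φ_{t-s} x)` joins `u 0 (Φ_t x)` at `s = 0` to `u t x` at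
  -- `s = t`. Its derivative is zero because the motion of the point cancels `{u, H}`.
  have hd : ∀ s, HasDerivAt (fun s => u s (flow m ν κ (t - s) x)) 0 s := by
    intro s
    have h1 := (hasDerivAt_flow hm hν hκ (t - s) x).scomp s ((hasDerivAt_id s).const_sub t)
    have h2 := hasDerivAt_eval_curve (hu s) h1
    refine h2.congr_deriv ?_
    rw [Function.comp_apply, poissonWith_hamSmooth]
    simp [dirD_apply]
  have hc := is_const_of_deriv_eq_zero (fun s => (hd s).differentiableAt)
    (fun s => (hd s).deriv) t 0
  simp only [sub_self, sub_zero, flow_zero] at hc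
  exact hc

/-- Comparing coefficients of order `n + 1` divides by `ħ`, and the equation decouples order by
order. -/
theorem heisenbergEq_iff (γ : ℝ → (SmoothFn TotalPhase)⟦X⟧) :
    HeisenbergEq starTotal (hamFormal m ν κ) γ ↔ ∀ n t,
      Tendsto (fun h : ℝ => ((h⁻¹ : ℝ) : ℂ) • (coeff n (γ (t + h)) - coeff n (γ t))) (𝓝[≠] 0)
        (𝓝 (poissonWith dirQ dirP (hamSmooth m ν κ) (coeff n (γ t)))) := by
  have key : ∀ f, Complex.I • (starTotal (hamFormal m ν κ) f - starTotal f (hamFormal m ν κ)) =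
      X * PowerSeries.mk fun n => poissonWith dirQ dirP (hamSmooth m ν κ) (coeff n f) :=
    weylStar_commutator_of_quadratic dirQ dirP (dirD_dirD_dirD_hamSmooth m ν κ)
  simp only [HeisenbergEq, key]
  constructor
  · intro h n t
    obtain ⟨g, hg, he⟩ := h t
    have := hg n
    have hn := congrArg (coeff (n + 1)) he
    rw [coeff_succ_X_mul, coeff_succ_X_mul, coeff_mk] at hn
    rwa [hn] at this
  · intro h t
    exact ⟨_, fun n => by rw [coeff_mk]; exact h n t, rfl⟩

theorem heisenbergEq_solution_iff (hm : 0 < m) (hν : 0 < ν) (hκ : 0 < κ)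
    (f : (SmoothFn TotalPhase)⟦X⟧) (γ : ℝ → (SmoothFn TotalPhase)⟦X⟧) :
    (γ 0 = f ∧ HeisenbergEq starTotal (hamFormal m ν κ) γ) ↔ ∀ t, γ t = flowPull m ν κ t f := by
  rw [heisenbergEq_iff]
  constructor
  · rintro ⟨rfl, h⟩ t
    ext n : 1
    rw [flowPull, coeff_liftOp]
    exact eq_flowPb_of_tendsto_slope hm hν hκ (u := fun s => coeff n (γ s)) (h n) t
  · intro h
    refine ⟨?_, fun n t => ?_⟩
    · rw [h]
      ext n : 1
      rw [flowPull, coeff_liftOp]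
      exact SmoothFn.ext fun x => congrArg (coeff n f).1 (flow_zero m ν κ x)
    · simp only [h, flowPull, coeff_liftOp]
      exact tendsto_slope_flowPb hm hν hκ (coeff n f) t

/-! ### Normal modes and the Wick equivalence. -/

theorem modeFreq_pos (hm : 0 < m) (hν : 0 < ν) (hκ : 0 < κ) (k : Fin 2) :
    0 < modeFreq m ν κ k := by
  fin_cases k
  · exact hν
  · exact freq_pos hm hν hκ

/-- On sums and differences of system and bath directions only one frequency survives, and the flow
is that of a single oscillator. -/
theorem flow_modeQ (hm : 0 < m) (hν : 0 < ν) (hκ : 0 < κ) (t : ℝ) (k : Fin 2) :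
    flow m ν κ t (modeQ k) = Real.cos (modeFreq m ν κ k * t) • modeQ k +
      (-(m * modeFreq m ν κ k * Real.sin (modeFreq m ν κ k * t))) • modeP k := by
  have hμ := freq_pos hm hν hκ
  fin_cases k <;> ext <;> simp [flow, modeQ, modeP, modeFreq, dirQ, dirP] <;> ring

theorem flow_modeP (hm : 0 < m) (hν : 0 < ν) (hκ : 0 < κ) (t : ℝ) (k : Fin 2) :
    flow m ν κ t (modeP k) =
      (Real.sin (modeFreq m ν κ k * t) / (m * modeFreq m ν κ k)) • modeQ k +
        Real.cos (modeFreq m ν κ k * t) • modeP k := by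
  have hμ := freq_pos hm hν hκ
  fin_cases k <;> ext <;> simp [flow, modeQ, modeP, modeFreq, dirQ, dirP] <;> ring

theorem dirD_flowPb (t : ℝ) (v : TotalPhase) (f : SmoothFn TotalPhase) :
    dirD v (flowPb m ν κ t f) = flowPb m ν κ t (dirD (flow m ν κ t v) f) :=
  dirD_pullback (flowLin m ν κ t) (contDiff_flow m ν κ t) v f

/-- In the rescaled coordinates of mode `k` the flow is a rotation, so `∂/∂z_k` picks up the phase
`exp (-i ν_k t)`. -/
theorem dZ_flowPb (hm : 0 < m) (hν : 0 < ν) (hκ : 0 < κ) (t : ℝ) (k : Fin 2)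
    (f : SmoothFn TotalPhase) : dZ m ν κ k (flowPb m ν κ t f) =
      ((Real.cos (modeFreq m ν κ k * t) : ℂ) - Complex.I * Real.sin (modeFreq m ν κ k * t)) •
        flowPb m ν κ t (dZ m ν κ k f) := by
  have hs : 0 < √(m * modeFreq m ν κ k) := Real.sqrt_pos.2 (mul_pos hm (modeFreq_pos hm hν hκ k))
  have hs2 : m * modeFreq m ν κ k = √(m * modeFreq m ν κ k) ^ 2 :=
    (Real.sq_sqrt (mul_pos hm (modeFreq_pos hm hν hκ k)).le).symm
  simp only [dZ, LinearMap.add_apply, LinearMap.smul_apply, dirD_flowPb, flow_modeQ hm hν hκ,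
    flow_modeP hm hν hκ, dirD_add_left, dirD_smul_left, map_add, map_smul]
  -- Writing `m ν_k = s²` leaves an algebraic identity in `s`, the sine, the cosine and `I`.
  generalize √(m * modeFreq m ν κ k) = s at *
  rw [hs2]
  generalize Real.sin _ = sn
  generalize Real.cos _ = c
  have hs' : (s : ℂ) ≠ 0 := by exact_mod_cast hs.ne'
  have hI := Complex.I_sq
  push_cast
  match_scalars <;> field_simp
  · linear_combination (sn : ℂ) * hI
  · ring

theorem dZbar_flowPb (hm : 0 < m) (hν : 0 < ν) (hκ : 0 < κ) (t : ℝ) (k : Fin 2)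
    (f : SmoothFn TotalPhase) : dZbar m ν κ k (flowPb m ν κ t f) =
      ((Real.cos (modeFreq m ν κ k * t) : ℂ) + Complex.I * Real.sin (modeFreq m ν κ k * t)) •
        flowPb m ν κ t (dZbar m ν κ k f) := by
  have hs : 0 < √(m * modeFreq m ν κ k) := Real.sqrt_pos.2 (mul_pos hm (modeFreq_pos hm hν hκ k))
  have hs2 : m * modeFreq m ν κ k = √(m * modeFreq m ν κ k) ^ 2 :=
    (Real.sq_sqrt (mul_pos hm (modeFreq_pos hm hν hκ k)).le).symm
  simp only [dZbar, LinearMap.sub_apply, LinearMap.smul_apply, dirD_flowPb, flow_modeQ hm hν hκ,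
    flow_modeP hm hν hκ, dirD_add_left, dirD_smul_left, map_add, map_sub, map_smul]
  generalize √(m * modeFreq m ν κ k) = s at *
  rw [hs2]
  generalize Real.sin _ = sn
  generalize Real.cos _ = c
  have hs' : (s : ℂ) ≠ 0 := by exact_mod_cast hs.ne'
  have hI := Complex.I_sq
  push_cast
  match_scalars <;> field_simp
  · linear_combination -(sn : ℂ) * hI
  · ring

/-- `∂/∂z_k` and `∂/∂z̄_k` acquire inverse phases, which cancel in each summand of `Δ`. -/
theorem commute_flowPb_wickLaplacian (hm : 0 < m) (hν : 0 < ν) (hκ : 0 < κ) (t : ℝ) :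
    Commute (flowPb m ν κ t) (wickLaplacian m ν κ) := by
  refine LinearMap.ext fun f => ?_
  simp only [Module.End.mul_apply, wickLaplacian, LinearMap.sum_apply, LinearMap.comp_apply,
    map_sum, dZbar_flowPb hm hν hκ, map_smul, dZ_flowPb hm hν hκ, smul_smul]
  refine Finset.sum_congr rfl fun k _ => ?_
  have h : ((Real.cos (modeFreq m ν κ k * t) : ℂ) +
      Complex.I * Real.sin (modeFreq m ν κ k * t)) * ((Real.cos (modeFreq m ν κ k * t) : ℂ) -
      Complex.I * Real.sin (modeFreq m ν κ k * t)) = 1 := by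
    have h1 : ((Real.cos (modeFreq m ν κ k * t) : ℂ)) ^ 2 +
        (Real.sin (modeFreq m ν κ k * t) : ℂ) ^ 2 = 1 := by
      exact_mod_cast Real.cos_sq_add_sin_sq _
    linear_combination h1 - (Real.sin (modeFreq m ν κ k * t) : ℂ) ^ 2 * Complex.I_sq
  rw [h, one_smul]

/-- The Wick equivalence commutes with the classical time evolution. -/
theorem wickS_conj_flowPull (hm : 0 < m) (hν : 0 < ν) (hκ : 0 < κ) (t : ℝ) :
    (wickS m ν κ).symm.toLinearMap ∘ₗ flowPull m ν κ t ∘ₗ (wickS m ν κ).toLinearMap =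
      flowPull m ν κ t := by
  refine LinearMap.ext fun f => (wickS m ν κ).symm_apply_eq.2 ?_
  exact liftOp_expOp_of_commute (commute_flowPb_wickLaplacian hm hν hκ t) f

theorem isQuantumEvolution_iff (hm : 0 < m) (hν : 0 < ν) (hκ : 0 < κ)
    (A : ℝ → (SmoothFn TotalPhase)⟦X⟧ →ₗ[ℂ⟦X⟧] (SmoothFn TotalPhase)⟦X⟧) :
    IsQuantumEvolution starTotal (hamFormal m ν κ) A ↔
      ∀ t, A t = (wickS m ν κ).symm.toLinearMap ∘ₗ flowPull m ν κ t ∘ₗ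
        (wickS m ν κ).toLinearMap := by
  simp only [wickS_conj_flowPull hm hν hκ, IsQuantumEvolution, heisenbergEq_solution_iff hm hν hκ]
  constructor
  · intro h t
    -- The equivalence is tested on the curve `t ↦ A t f` itself.
    exact LinearMap.ext fun f => ((h f fun t => A t f).2 (fun _ => rfl) t)
  · intro h f γ
    simp only [h]

end Oscillators

end OpenOsc

/-- For two linearly coupled identical oscillators, the total quantum time evolution with respect
to the Weyl-Moyal star product is `S⁻¹ ∘ Φ_t^* ∘ S`, where `Φ_t` is the flow of the total
Hamiltonian, and the quantized open time evolution is
`(id ⊗ om) ∘ S⁻¹ ∘ Φ_t^* ∘ S ∘ pr_S^*`. -/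
theorem mainTheorem8 (m ν κ : ℝ) (hm : 0 < m) (hν : 0 < ν) (hκ : 0 < κ) :
    (∀ Ψ : ℝ → TotalPhase → TotalPhase,
      IsFlow (hamVectorField dirQ dirP (hamTotal m ν κ)) Ψ ↔ Ψ = flow m ν κ) ∧
    (∀ A : ℝ → (SmoothFn TotalPhase)⟦X⟧ →ₗ[ℂ⟦X⟧] (SmoothFn TotalPhase)⟦X⟧,
      IsQuantumEvolution starTotal (hamFormal m ν κ) A ↔
        ∀ t, A t = (wickS m ν κ).symm.toLinearMap ∘ₗ flowPull m ν κ t ∘ₗ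
          (wickS m ν κ).toLinearMap) ∧
    (∀ A : ℝ → (SmoothFn TotalPhase)⟦X⟧ →ₗ[ℂ⟦X⟧] (SmoothFn TotalPhase)⟦X⟧,
      IsQuantumEvolution starTotal (hamFormal m ν κ) A → ∀ (om : BathState) (t : ℝ),
        openEvolution A om t =
          om.idTensor ∘ₗ (wickS m ν κ).symm.toLinearMap ∘ₗ flowPull m ν κ t ∘ₗ
            (wickS m ν κ).toLinearMap ∘ₗ prSys) := by
  refine ⟨isFlow_iff hm hν hκ, isQuantumEvolution_iff hm hν hκ, fun A hA om t => ?_⟩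
  rw [openEvolution, (isQuantumEvolution_iff hm hν hκ A).1 hA t]
  rfl
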